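/- Let $S$ be a semigroup with zero $0$. A $0$-module over $S$ is an abelian group $A$ with a multiplication $(S\setminus 0)\times A\to A$ such that $s(a+b)=sa+sb$ for all $s\in S\setminus 0$ and $a,b\in A$, and $s(ta)=(st)a$ whenever $s,t\in S\setminus 0$ and $st\neq 0$. **Gown.** Let $\overline S$ be the set of finite sequences $(x_1,\dots,x_m)$, $m\ge 1$, with $x_i\in S\setminus 0$ and $x_ix_{i+1}=0$ for $1\le i<m$. Let $\overline\rho$ be the least equivalence relation on $\overline S$ that contains the following pairs (all the sequences being in $\overline S$; $p,q$ are possibly empty blocks and $u,v\in S$): $$(p,\,au,\,b,\,q)\ \overline\rho\ (p,\,a,\,ub,\,q),\qquad (p,\,a,\,uv,\,b,\,q)\ \overline\rho\ (p,\,au,\,vb,\,q).$$ The gown of $S$ is the semigroup $\tilde S=\overline S/\overline\rho$ with the multiplication of classes $$[x_1,\dots,x_m][y_1,\dots,y_n]=\begin{cases}[x_1,\dots,x_my_1,\dots,y_n], & x_my_1\ne 0,\\ [x_1,\dots,x_m,y_1,\dots,y_n], & x_my_1=0.\end{cases}$$ Every $0$-module $A$ over $S$ is a module over $\tilde S$ via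 $[x_1,\dots,x_m]a=x_1(\cdots(x_ma)\cdots)$. **Cohomology.** For a semigroup $T$ and a $T$-module $A$, let $C^n(T,A)$ be the group of all maps $T^n\to A$, and let $$\partial^nf(x_1,\dots,x_{n+1})=x_1f(x_2,\dots,x_{n+1})+\sum_{i=1}^n(-1)^if(x_1,\dots,x_ix_{i+1},\dots,x_{n+1})+(-1)^{n+1}f(x_1,\dots,x_n).$$ The Eilenberg–MacLane cohomology is $H^n(T,A)=\operatorname{Ker}\partial^n/\operatorname{Im}\partial^{n-1}$ (with $\operatorname{Im}\partial^{-1}=0$). For a $0$-module $A$ over $S$, let $C_0^n(S,A)$ be the group of all maps to $A$ from the set of $n$-tuples $(x_1,\dots,x_n)$ of elements of $S$ with $x_1\cdots x_n\neq 0$ (for $n=0$ the empty tuple is admitted, so $C_0^0(S,A)=A$). The same formula defines $\partial^n:C_0^n(S,A)\to C_0^{n+1}(S,A)$, and the $0$-cohomology is $H_0^n(S,A)=\operatorname{Ker}\partial^n/\operatorname{Im}\partial^{n-1}$. **Comparison map.** The homomorphisms $\eta^n:C^n(\tilde S,A)\to C_0^n(S,A)$, $(\eta^nf)(x_1,\dots,x_n)=f([x_1],\dots,[x_n])$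 for $x_1\cdots x_n\ne 0$, commute with the coboundary operators and induce group homomorphisms $\varepsilon^n:H^n(\tilde S,A)\to H_0^n(S,A)$. **Theorem 5.** If $S$ is categorical at zero, that is, if for all $x,y,z\in S$ the equality $xyz=0$ implies $xy=0$ or $yz=0$, then $\varepsilon^n$ is an isomorphism for every $0$-module $A$ over $S$ and every $n\ge 0$. -/

import Mathlib

universe u v

namespace ZeroCohomology

noncomputable section

open Classical

/-! ### Eilenberg–MacLane cohomology of a semigroup -/

/-- A (left) module over a semigroup `T`: an abelian group on which `T` acts by additive maps,
compatibly with the multiplication of `T`. -/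
class SemigroupModule (T : Type u) (A : Type v) [Semigroup T] [AddCommGroup A] extends
    SMul T A where
  smul_add : ∀ (t : T) (a b : A), t • (a + b) = t • a + t • b
  mul_smul : ∀ (s t : T) (a : A), (s * t) • a = s • t • a

section EM

variable (T : Type u) (A : Type v) [Semigroup T] [AddCommGroup A] [SemigroupModule T A]

/-- The group `C^n(T, A)` of all `n`-place mappings from `T` to `A`. -/
abbrev Cochain (n : ℕ) : Type (max u v) := (Fin n → T) → A

/-- The coboundary operator `∂^n : C^n(T, A) → C^{n+1}(T, A)`. The tuple `x` is indexed from `0`.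
For `j < n` the tuple `Fin.contractNth j (· * ·) x` is `(x_0, …, x_j x_{j+1}, …, x_n)`; for `j = n`
it is `(x_0, …, x_{n-1})`, so the last summand is `(-1)^{n+1} f (x_0, …, x_{n-1})`. -/
def coboundary (n : ℕ) : Cochain T A n →+ Cochain T A (n + 1) where
  toFun f := fun x =>
    x 0 • f (fun i => x i.succ) +
      ∑ j : Fin (n + 1), (-1 : ℤ) ^ ((j : ℕ) + 1) • f (Fin.contractNth j (· * ·) x)
  map_zero' := by
    funext x
    have h : x 0 • (0 : A) = 0 := by
      have := SemigroupModule.smul_add (x 0) (0 : A) 0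
      simpa using this
    simp [h]
  map_add' f g := by
    funext x
    simp only [Pi.add_apply, SemigroupModule.smul_add, smul_add, Finset.sum_add_distrib]
    abel

/-- `Z^n(T, A)`, the kernel of `∂^n`. -/
def cocycles (n : ℕ) : AddSubgroup (Cochain T A n) := (coboundary T A n).ker

/-- `B^n(T, A)`, the image of `∂^{n-1}`; it is trivial for `n = 0`. -/
def coboundaries : (n : ℕ) → AddSubgroup (Cochain T A n)
  | 0 => ⊥
  | n + 1 => (coboundary T A n).range

/-- The Eilenberg–MacLane cohomology group `H^n(T, A) = Z^n(T, A) / B^n(T, A)`, with `B^n(T, A)`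
regarded as a subgroup of `Z^n(T, A)` (it is contained in it as `∂ ∘ ∂ = 0`). -/
abbrev EMCohomology (n : ℕ) : Type (max u v) :=
  cocycles T A n ⧸ (coboundaries T A n).addSubgroupOf (cocycles T A n)

end EM

/-! ### 0-modules and 0-cohomology of a semigroup with zero -/

/-- The set `S \ 0`. -/
abbrev NZ (S : Type u) [Zero S] : Type u := {s : S // s ≠ 0}

/-- A 0-module over a semigroup `S` with zero: an abelian group `A` with a multiplication
`(S \ 0) × A → A` such that `s (a + b) = s a + s b`, and `s (t a) = (s t) a` whenever `s t ≠ 0`. -/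
class ZeroModule (S : Type u) (A : Type v) [SemigroupWithZero S] [AddCommGroup A] where
  act : NZ S → A → A
  act_add : ∀ (s : NZ S) (a b : A), act s (a + b) = act s a + act s b
  act_act : ∀ (s t : NZ S) (h : s.1 * t.1 ≠ 0) (a : A),
    act s (act t a) = act ⟨s.1 * t.1, h⟩ a

/-- `S` is categorical at zero if `x y z = 0` implies `x y = 0` or `y z = 0`. -/
def CategoricalAtZero (S : Type u) [SemigroupWithZero S] : Prop :=
  ∀ x y z : S, x * y * z = 0 → x * y = 0 ∨ y * z = 0

section Tuples

variable {S : Type u} [SemigroupWithZero S]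

/-- The product `x_1 ⋯ x_n` of a tuple, taken in `S` with an identity adjoined, so that the product
of the empty tuple is `1`. -/
def tupleProd {n : ℕ} (x : Fin n → S) : WithOne S := (List.ofFn fun i => (x i : WithOne S)).prod

/-- `x_1 ⋯ x_n ≠ 0`. The empty tuple satisfies this. -/
def NonzeroProd {n : ℕ} (x : Fin n → S) : Prop := tupleProd x ≠ ((0 : S) : WithOne S)

theorem coe_zero_mul (w : WithOne S) : ((0 : S) : WithOne S) * w = ((0 : S) : WithOne S) := by
  cases w with
  | one => simp
  | coe a => rw [← WithOne.coe_mul, zero_mul]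

theorem mul_coe_zero (w : WithOne S) : w * ((0 : S) : WithOne S) = ((0 : S) : WithOne S) := by
  cases w with
  | one => simp
  | coe a => rw [← WithOne.coe_mul, mul_zero]

theorem tupleProd_succ {n : ℕ} (x : Fin (n + 1) → S) :
    tupleProd x = (x 0 : WithOne S) * tupleProd fun i => x i.succ := by
  simp [tupleProd, List.ofFn_succ]

theorem tupleProd_eq_partialProd {n : ℕ} (x : Fin n → S) :
    tupleProd x = Fin.partialProd (fun i => (x i : WithOne S)) (Fin.last n) := by
  unfold tupleProd Fin.partialProd
  rw [List.take_of_length_le (by simp)]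

theorem NonzeroProd.head {n : ℕ} {x : Fin (n + 1) → S} (h : NonzeroProd x) : x 0 ≠ 0 := by
  intro h0
  apply h
  rw [tupleProd_succ, h0, coe_zero_mul]

theorem NonzeroProd.tail {n : ℕ} {x : Fin (n + 1) → S} (h : NonzeroProd x) :
    NonzeroProd fun i => x i.succ := by
  intro h0
  apply h
  rw [tupleProd_succ, h0, mul_coe_zero]

theorem NonzeroProd.contract {n : ℕ} {x : Fin (n + 1) → S} (h : NonzeroProd x)
    (j : Fin (n + 1)) : NonzeroProd (Fin.contractNth j (· * ·) x) := by
  have key : tupleProd (Fin.contractNth j (· * ·) x) =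
      Fin.partialProd (fun i => (x i : WithOne S)) (j.succ.succAbove (Fin.last n)) := by
    rw [tupleProd_eq_partialProd]
    have := congrFun (Fin.partialProd_contractNth (fun i => (x i : WithOne S)) j) (Fin.last n)
    rw [Function.comp_apply] at this
    rw [← this]
    congr 1
    funext k
    unfold Fin.contractNth
    split_ifs <;> simp
  intro h0
  rw [key] at h0
  apply h
  rw [tupleProd_eq_partialProd]
  induction j using Fin.lastCases with
  | last =>
    rw [Fin.succ_last, Fin.succAbove_last] at h0
    rw [← Fin.succ_last, Fin.partialProd_succ, h0, coe_zero_mul]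
  | cast j =>
    rwa [Fin.succAbove_of_le_castSucc _ _ (by
      rw [Fin.le_def]; simp), Fin.succ_last] at h0

theorem NonzeroProd.ne_zero : ∀ {n : ℕ} {x : Fin n → S}, NonzeroProd x → ∀ i, x i ≠ 0
  | 0, _, _, i => i.elim0
  | _ + 1, _, h, i => by
    induction i using Fin.cases with
    | zero => exact h.head
    | succ i => exact NonzeroProd.ne_zero h.tail i

end Tuples

section Zero

variable (S : Type u) (A : Type v) [SemigroupWithZero S] [AddCommGroup A] [ZeroModule S A]

/-- The group `C_0^n(S, A)` of partial `n`-place mappings from `S` to `A`, defined on all `n`-tuples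
with nonzero product; in particular `C_0^0(S, A) = A`. -/
abbrev ZeroCochain (n : ℕ) : Type (max u v) := {x : Fin n → S // NonzeroProd x} → A

/-- The coboundary operator `∂^n : C_0^n(S, A) → C_0^{n+1}(S, A)`, given by the same formula as
`coboundary`. -/
def zeroCoboundary (n : ℕ) : ZeroCochain S A n →+ ZeroCochain S A (n + 1) where
  toFun f := fun x =>
    ZeroModule.act (⟨x.1 0, x.2.head⟩ : NZ S) (f ⟨fun i => x.1 i.succ, x.2.tail⟩) +
      ∑ j : Fin (n + 1), (-1 : ℤ) ^ ((j : ℕ) + 1) •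
        f ⟨Fin.contractNth j (· * ·) x.1, x.2.contract j⟩
  map_zero' := by
    funext x
    have h : ZeroModule.act (⟨x.1 0, x.2.head⟩ : NZ S) (0 : A) = 0 := by
      have := ZeroModule.act_add (⟨x.1 0, x.2.head⟩ : NZ S) (0 : A) 0
      simpa using this
    simp [h]
  map_add' f g := by
    funext x
    simp only [Pi.add_apply, ZeroModule.act_add, smul_add, Finset.sum_add_distrib]
    abel

/-- `Z_0^n(S, A)`, the kernel of `∂^n`. -/
def zeroCocycles (n : ℕ) : AddSubgroup (ZeroCochain S A n) := (zeroCoboundary S A n).ker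

/-- `B_0^n(S, A)`, the image of `∂^{n-1}`; it is trivial for `n = 0`. -/
def zeroCoboundaries : (n : ℕ) → AddSubgroup (ZeroCochain S A n)
  | 0 => ⊥
  | n + 1 => (zeroCoboundary S A n).range

/-- The 0-cohomology group `H_0^n(S, A) = Z_0^n(S, A) / B_0^n(S, A)`, with `B_0^n(S, A)` regarded
as a subgroup of `Z_0^n(S, A)` (it is contained in it as `∂ ∘ ∂ = 0`). -/
abbrev ZeroCohomologyGroup (n : ℕ) : Type (max u v) :=
  zeroCocycles S A n ⧸ (zeroCoboundaries S A n).addSubgroupOf (zeroCocycles S A n)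

end Zero

/-! ### The gown of a semigroup with zero -/

section Gown

/-- The set of nonempty finite sequences of nonzero elements with `x_i x_{i+1} = 0`. -/
def Seq (S : Type u) [SemigroupWithZero S] : Type u :=
  {l : List (NZ S) // l ≠ [] ∧ l.IsChain fun x y => x.1 * y.1 = 0}

/-- The relation `ρ`, on underlying lists. -/
inductive Rho {S : Type u} [SemigroupWithZero S] : List (NZ S) → List (NZ S) → Prop
  | slide (p q : List (NZ S)) (x₁ x₂ y₁ y₂ : NZ S) (w : S)
      (h₁ : x₁.1 = y₁.1 * w) (h₂ : y₂.1 = w * x₂.1) :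
      Rho (p ++ x₁ :: x₂ :: q) (p ++ y₁ :: y₂ :: q)
  | split (p q : List (NZ S)) (x₀ x₁ x₂ y₀ y₁ : NZ S) (w z : S)
      (h : x₁.1 = w * z) (h₀ : y₀.1 = x₀.1 * w) (h₁ : y₁.1 = z * x₂.1) :
      Rho (p ++ x₀ :: x₁ :: x₂ :: q) (p ++ y₀ :: y₁ :: q)

/-- The underlying set of the gown: the quotient of the set of sequences by the least equivalence
relation containing `ρ`. -/
def Gown (S : Type u) [SemigroupWithZero S] : Type u :=
  Quot fun l m : Seq S => Rho l.1 m.1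

variable {S : Type u} [SemigroupWithZero S]

/-- `(x_1, …, x_m) (y_1, …, y_n)` is `(x_1, …, x_m y_1, …, y_n)` if `x_m y_1 ≠ 0`, and
`(x_1, …, x_m, y_1, …, y_n)` if `x_m y_1 = 0`. -/
def glue : List (NZ S) → List (NZ S) → List (NZ S)
  | [], m => m
  | [x], [] => [x]
  | [x], y :: m => if h : x.1 * y.1 = 0 then x :: y :: m else ⟨x.1 * y.1, h⟩ :: m
  | x :: x' :: l, m => x :: glue (x' :: l) m

theorem glue_concat_cons (p : List (NZ S)) (x y : NZ S) (q : List (NZ S)) :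
    glue (p ++ [x]) (y :: q) =
      p ++ if h : x.1 * y.1 = 0 then x :: y :: q else ⟨x.1 * y.1, h⟩ :: q := by
  induction p with
  | nil => simp [glue]
  | cons a p ih =>
    cases p with
    | nil => simp [glue]
    | cons b p => simpa [glue] using ih

theorem glue_of_eq_zero {p : List (NZ S)} {x y : NZ S} {q : List (NZ S)} (h : x.1 * y.1 = 0) :
    glue (p ++ [x]) (y :: q) = p ++ x :: y :: q := by
  rw [glue_concat_cons, dif_pos h]

theorem glue_of_ne_zero {p : List (NZ S)} {x y : NZ S} {q : List (NZ S)} (h : x.1 * y.1 ≠ 0) :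
    glue (p ++ [x]) (y :: q) = p ++ ⟨x.1 * y.1, h⟩ :: q := by
  rw [glue_concat_cons, dif_neg h]

theorem glue_append_left (p : List (NZ S)) {l : List (NZ S)} (hl : l ≠ []) (m : List (NZ S)) :
    glue (p ++ l) m = p ++ glue l m := by
  induction p with
  | nil => rfl
  | cons a p ih =>
    obtain ⟨b, k, hk⟩ : ∃ b k, p ++ l = b :: k := List.exists_cons_of_ne_nil (by simp [hl])
    rw [List.cons_append, hk, glue, ← hk, ih, List.cons_append]

theorem glue_append_right {l m : List (NZ S)} (hl : l ≠ []) (hm : m ≠ []) (q : List (NZ S)) :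
    glue l (m ++ q) = glue l m ++ q := by
  obtain ⟨p, x, rfl⟩ := List.eq_nil_or_concat' l |>.resolve_left hl
  obtain ⟨y, m, rfl⟩ := List.exists_cons_of_ne_nil hm
  rw [List.cons_append, glue_concat_cons, glue_concat_cons]
  split_ifs <;> simp

theorem glue_ne_nil {l m : List (NZ S)} (hl : l ≠ []) (hm : m ≠ []) : glue l m ≠ [] := by
  obtain ⟨p, x, rfl⟩ := List.eq_nil_or_concat' l |>.resolve_left hl
  obtain ⟨y, m, rfl⟩ := List.exists_cons_of_ne_nil hm
  rw [glue_concat_cons]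
  split_ifs <;> simp

theorem glue_isChain {l m : List (NZ S)} (hl : l ≠ []) (hm : m ≠ [])
    (cl : l.IsChain fun x y => x.1 * y.1 = 0) (cm : m.IsChain fun x y => x.1 * y.1 = 0) :
    (glue l m).IsChain fun x y => x.1 * y.1 = 0 := by
  obtain ⟨p, x, rfl⟩ := List.eq_nil_or_concat' l |>.resolve_left hl
  obtain ⟨y, m, rfl⟩ := List.exists_cons_of_ne_nil hm
  by_cases h : x.1 * y.1 = 0
  · rw [glue_of_eq_zero h, List.isChain_append_cons_cons]
    exact ⟨cl, h, cm⟩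
  · rw [glue_of_ne_zero h, List.isChain_split]
    constructor
    · rw [List.isChain_append] at cl ⊢
      refine ⟨cl.1, List.isChain_singleton _, fun a ha b hb => ?_⟩
      have := cl.2.2 a ha x (by simp)
      simp only [List.head?_cons, Option.mem_some_iff] at hb
      subst hb
      simp only [← mul_assoc, this, zero_mul]
    · rw [List.isChain_cons] at cm ⊢
      refine ⟨fun b hb => ?_, cm.2⟩
      simp only [mul_assoc, cm.1 b hb, mul_zero]

/-- Multiplication of sequences. -/
def Seq.mul (l m : Seq S) : Seq S :=
  ⟨glue l.1 m.1, glue_ne_nil l.2.1 m.2.1, glue_isChain l.2.1 m.2.1 l.2.2 m.2.2⟩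

/-- The class `[x_1, …, x_m]` of a sequence in the gown. -/
def Gown.mk (l : Seq S) : Gown S := Quot.mk _ l

theorem Gown.sound {l m : Seq S} (h : Rho l.1 m.1) : Gown.mk l = Gown.mk m := Quot.sound h

theorem Rho.append_left (p : List (NZ S)) {l m : List (NZ S)} (h : Rho l m) :
    Rho (p ++ l) (p ++ m) := by
  cases h with
  | slide p' q x₁ x₂ y₁ y₂ w h₁ h₂ =>
    simpa using Rho.slide (p ++ p') q x₁ x₂ y₁ y₂ w h₁ h₂
  | split p' q x₀ x₁ x₂ y₀ y₁ w z h h₀ h₁ =>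
    simpa using Rho.split (p ++ p') q x₀ x₁ x₂ y₀ y₁ w z h h₀ h₁

theorem Rho.append_right (q : List (NZ S)) {l m : List (NZ S)} (h : Rho l m) :
    Rho (l ++ q) (m ++ q) := by
  cases h with
  | slide p q' x₁ x₂ y₁ y₂ w h₁ h₂ =>
    simpa using Rho.slide p (q' ++ q) x₁ x₂ y₁ y₂ w h₁ h₂
  | split p q' x₀ x₁ x₂ y₀ y₁ w z h h₀ h₁ =>
    simpa using Rho.split p (q' ++ q) x₀ x₁ x₂ y₀ y₁ w z h h₀ h₁

/-- Multiplication on the left respects the equivalence relation generated by `ρ`. -/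
theorem Gown.mk_mul_congr_right (k l m : Seq S) (h : Rho l.1 m.1) :
    Gown.mk (k.mul l) = Gown.mk (k.mul m) := by
  obtain ⟨k, hk, ck⟩ := k
  obtain ⟨l, hl, cl⟩ := l
  obtain ⟨m, hm, cm⟩ := m
  obtain ⟨r, t, rfl⟩ := List.eq_nil_or_concat' k |>.resolve_left hk
  have cL := glue_isChain hk hl ck cl
  have cM := glue_isChain hk hm ck cm
  dsimp only at h
  cases h with
  | slide p q x₁ x₂ y₁ y₂ w h₁ h₂ =>
    cases p with
    | cons a p =>
      apply Gown.sound
      have e := (Rho.slide p q x₁ x₂ y₁ y₂ w h₁ h₂).append_left (glue (r ++ [t]) [a])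
      rw [← glue_append_right hk (by simp), ← glue_append_right hk (by simp)] at e
      exact e
    | nil =>
      apply Gown.sound
      simp only [Seq.mul, List.nil_append]
      by_cases hx : t.1 * x₁.1 = 0
      · rw [glue_of_eq_zero hx]
        by_cases hy : t.1 * y₁.1 = 0
        · rw [glue_of_eq_zero hy]
          simpa using Rho.slide (r ++ [t]) q x₁ x₂ y₁ y₂ w h₁ h₂
        · rw [glue_of_ne_zero hy]
          exact Rho.split r q t x₁ x₂ _ y₂ y₁.1 w h₁ rfl h₂
      · have hy : t.1 * y₁.1 ≠ 0 := by
          intro h0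
          apply hx
          rw [h₁, ← mul_assoc, h0, zero_mul]
        rw [glue_of_ne_zero hx, glue_of_ne_zero hy]
        exact Rho.slide r q _ x₂ _ y₂ w (by simp [h₁, mul_assoc]) h₂
  | split p q x₀ x₁ x₂ y₀ y₁ w z h h₀ h₁ =>
    cases p with
    | cons a p =>
      apply Gown.sound
      have e := (Rho.split p q x₀ x₁ x₂ y₀ y₁ w z h h₀ h₁).append_left (glue (r ++ [t]) [a])
      rw [← glue_append_right hk (by simp), ← glue_append_right hk (by simp)] at e
      exact e
    | nil =>
      simp only [Seq.mul, List.nil_append] at cL cM ⊢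
      by_cases hx : t.1 * x₀.1 = 0
      · have hy : t.1 * y₀.1 = 0 := by rw [h₀, ← mul_assoc, hx, zero_mul]
        apply Gown.sound
        dsimp only
        rw [glue_of_eq_zero hx, glue_of_eq_zero hy]
        simpa using Rho.split (r ++ [t]) q x₀ x₁ x₂ y₀ y₁ w z h h₀ h₁
      · by_cases hy : t.1 * y₀.1 = 0
        · have hw : w ≠ 0 := by
            rintro rfl
            exact y₀.2 (by rw [h₀, mul_zero])
          have c0 : t.1 * x₀.1 * w = 0 := by rw [mul_assoc, ← h₀, hy]
          have c1 : w * y₁.1 = 0 := by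
            rw [h₁, ← mul_assoc, ← h]
            rw [List.nil_append, List.isChain_cons_cons, List.isChain_cons_cons] at cl
            exact cl.2.1
          have cN : (r ++ ⟨t.1 * x₀.1, hx⟩ :: (⟨w, hw⟩ : NZ S) :: y₁ :: q).IsChain
              fun x y => x.1 * y.1 = 0 := by
            rw [glue_of_ne_zero hx] at cL
            rw [glue_of_eq_zero hy] at cM
            rw [List.isChain_append_cons_cons, List.isChain_cons_cons]
            rw [List.isChain_append_cons_cons, List.isChain_cons_cons] at cM
            rw [List.isChain_split] at cL
            exact ⟨cL.1, c0, c1, cM.2.2.2⟩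
          trans Gown.mk ⟨_, by simp, cN⟩
          · apply Gown.sound
            dsimp only
            rw [glue_of_ne_zero hx]
            have e := Rho.slide (r ++ [⟨t.1 * x₀.1, hx⟩]) q x₁ x₂ ⟨w, hw⟩ y₁ z h h₁
            rw [List.append_assoc, List.append_assoc] at e
            exact e
          · apply Gown.sound
            dsimp only
            rw [glue_of_eq_zero hy]
            exact Rho.slide r (y₁ :: q) _ _ t y₀ x₀.1 rfl h₀
        · apply Gown.sound
          dsimp only
          rw [glue_of_ne_zero hx, glue_of_ne_zero hy]
          exact Rho.split r q _ x₁ x₂ _ y₁ w z h (by simp [h₀, mul_assoc]) h₁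

/-- Multiplication on the right respects the equivalence relation generated by `ρ`. -/
theorem Gown.mk_mul_congr_left (k l m : Seq S) (h : Rho l.1 m.1) :
    Gown.mk (l.mul k) = Gown.mk (m.mul k) := by
  obtain ⟨k, hk, ck⟩ := k
  obtain ⟨l, hl, cl⟩ := l
  obtain ⟨m, hm, cm⟩ := m
  obtain ⟨t, r, rfl⟩ := List.exists_cons_of_ne_nil hk
  have cL := glue_isChain hl hk cl ck
  have cM := glue_isChain hm hk cm ck
  dsimp only at h
  cases h with
  | slide p q x₁ x₂ y₁ y₂ w h₁ h₂ =>
    rcases List.eq_nil_or_concat' q with rfl | ⟨q, a, rfl⟩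
    · have e1 : p ++ [x₁, x₂] = (p ++ [x₁]) ++ [x₂] := by simp
      have e2 : p ++ [y₁, y₂] = (p ++ [y₁]) ++ [y₂] := by simp
      simp only [Seq.mul, e1, e2]
      by_cases hx : x₂.1 * t.1 = 0
      · have hy : y₂.1 * t.1 = 0 := by rw [h₂, mul_assoc, hx, mul_zero]
        apply Gown.sound
        dsimp only
        rw [glue_of_eq_zero hx, glue_of_eq_zero hy]
        simpa using Rho.slide p (t :: r) x₁ x₂ y₁ y₂ w h₁ h₂
      · by_cases hy : y₂.1 * t.1 = 0
        · symm
          apply Gown.sound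
          dsimp only
          rw [glue_of_ne_zero hx, glue_of_eq_zero hy]
          simpa using Rho.split p r y₁ y₂ t x₁ ⟨x₂.1 * t.1, hx⟩ w x₂.1 h₂ h₁ rfl
        · apply Gown.sound
          dsimp only
          rw [glue_of_ne_zero hx, glue_of_ne_zero hy]
          simpa using Rho.slide p r x₁ ⟨x₂.1 * t.1, hx⟩ y₁ ⟨y₂.1 * t.1, hy⟩ w h₁
            (by simp [h₂, mul_assoc])
    · apply Gown.sound
      have e := (Rho.slide p q x₁ x₂ y₁ y₂ w h₁ h₂).append_right (glue [a] (t :: r))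
      rw [← glue_append_left _ (by simp), ← glue_append_left _ (by simp)] at e
      simpa [Seq.mul] using e
  | split p q x₀ x₁ x₂ y₀ y₁ w z h h₀ h₁ =>
    rcases List.eq_nil_or_concat' q with rfl | ⟨q, a, rfl⟩
    · have e1 : p ++ [x₀, x₁, x₂] = (p ++ [x₀, x₁]) ++ [x₂] := by simp
      have e2 : p ++ [y₀, y₁] = (p ++ [y₀]) ++ [y₁] := by simp
      simp only [Seq.mul, e1, e2] at cL cM ⊢
      by_cases hx : x₂.1 * t.1 = 0
      · have hy : y₁.1 * t.1 = 0 := by rw [h₁, mul_assoc, hx, mul_zero]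
        apply Gown.sound
        dsimp only
        rw [glue_of_eq_zero hx, glue_of_eq_zero hy]
        simpa using Rho.split p (t :: r) x₀ x₁ x₂ y₀ y₁ w z h h₀ h₁
      · by_cases hy : y₁.1 * t.1 = 0
        · have hz : z ≠ 0 := by
            rintro rfl
            exact y₁.2 (by rw [h₁, zero_mul])
          have c0 : z * (x₂.1 * t.1) = 0 := by rw [← mul_assoc, ← h₁, hy]
          have c1 : y₀.1 * z = 0 := by
            rw [h₀, mul_assoc, ← h]
            rw [List.isChain_append_cons_cons] at cl
            exact cl.2.1
          have cN : (p ++ y₀ :: (⟨z, hz⟩ : NZ S) :: ⟨x₂.1 * t.1, hx⟩ :: r).IsChain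
              fun x y => x.1 * y.1 = 0 := by
            simp only [glue_of_ne_zero hx] at cL
            rw [List.isChain_append_cons_cons, List.isChain_cons_cons]
            rw [List.isChain_split] at cL
            rw [List.isChain_append_cons_cons] at cm
            exact ⟨cm.1, c1, c0, cL.2⟩
          trans Gown.mk ⟨_, by simp, cN⟩
          · symm
            apply Gown.sound
            dsimp only
            rw [glue_of_ne_zero hx]
            simpa using Rho.slide p (⟨x₂.1 * t.1, hx⟩ :: r) y₀ ⟨z, hz⟩ x₀ x₁ w h₀ h
          · symm
            apply Gown.sound
            dsimp only
            rw [glue_of_eq_zero hy]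
            simpa using Rho.slide (p ++ [y₀]) r y₁ t ⟨z, hz⟩ ⟨x₂.1 * t.1, hx⟩ x₂.1 h₁ rfl
        · apply Gown.sound
          dsimp only
          rw [glue_of_ne_zero hx, glue_of_ne_zero hy]
          simpa using Rho.split p r x₀ x₁ ⟨x₂.1 * t.1, hx⟩ y₀ ⟨y₁.1 * t.1, hy⟩ w z h h₀
            (by simp [h₁, mul_assoc])
    · apply Gown.sound
      have e := (Rho.split p q x₀ x₁ x₂ y₀ y₁ w z h h₀ h₁).append_right (glue [a] (t :: r))
      rw [← glue_append_left _ (by simp), ← glue_append_left _ (by simp)] at e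
      simpa [Seq.mul] using e

theorem Gown.mk_mul_assoc (k l m : Seq S) :
    Gown.mk ((k.mul l).mul m) = Gown.mk (k.mul (l.mul m)) := by
  obtain ⟨k, hk, ck⟩ := k
  obtain ⟨l, hl, cl⟩ := l
  obtain ⟨m, hm, cm⟩ := m
  obtain ⟨p, x, rfl⟩ := List.eq_nil_or_concat' k |>.resolve_left hk
  obtain ⟨z, q, rfl⟩ := List.exists_cons_of_ne_nil hm
  obtain ⟨y, l, rfl⟩ := List.exists_cons_of_ne_nil hl
  rcases List.eq_nil_or_concat' l with rfl | ⟨l, a, rfl⟩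
  · have hzq : z :: q = [z] ++ q := rfl
    have e1 : glue (glue (p ++ [x]) [y]) (z :: q) = p ++ (glue (glue [x] [y]) [z] ++ q) := by
      rw [glue_append_left p (by simp), glue_append_left p (glue_ne_nil (by simp) (by simp)),
        hzq, glue_append_right (glue_ne_nil (by simp) (by simp)) (by simp)]
    have e2 : glue (p ++ [x]) (glue [y] (z :: q)) = p ++ (glue [x] (glue [y] [z]) ++ q) := by
      rw [glue_append_left p (by simp), hzq, glue_append_right (by simp) (by simp),
        glue_append_right (by simp) (glue_ne_nil (by simp) (by simp))]
    by_cases hx : x.1 * y.1 = 0 <;> by_cases hz : y.1 * z.1 = 0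
    · congr 1
      apply Subtype.ext
      simp only [Seq.mul, e1, e2]
      simp [glue, hx, hz]
    · congr 1
      apply Subtype.ext
      simp only [Seq.mul, e1, e2]
      simp [glue, hx, hz, ← mul_assoc]
    · congr 1
      apply Subtype.ext
      simp only [Seq.mul, e1, e2]
      simp [glue, hx, hz, mul_assoc]
    · by_cases hxyz : x.1 * y.1 * z.1 = 0
      · apply Gown.sound
        simp only [Seq.mul, e1, e2]
        have h2 : x.1 * (y.1 * z.1) = 0 := by rw [← mul_assoc, hxyz]
        simp only [glue, hx, hz, hxyz, h2, dif_pos, dif_neg, not_false_eq_true]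
        exact Rho.slide p q _ z x _ y.1 rfl rfl
      · congr 1
        apply Subtype.ext
        simp only [Seq.mul, e1, e2]
        have h2 : x.1 * (y.1 * z.1) ≠ 0 := by rwa [← mul_assoc]
        simp [glue, hx, hz, h2, mul_assoc]
  · congr 1
    apply Subtype.ext
    simp only [Seq.mul]
    rw [← List.cons_append, glue_append_right hk (by simp),
      glue_append_left (glue (p ++ [x]) (y :: l)) (by simp), glue_append_left (y :: l) (by simp),
      glue_append_right hk (by simp)]

/-- The multiplication of sequences makes the gown a semigroup. -/
instance : Semigroup (Gown S) where
  mul := Quot.lift₂ (fun l m => Gown.mk (l.mul m)) Gown.mk_mul_congr_right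
    fun l m k h => Gown.mk_mul_congr_left k l m h
  mul_assoc := by
    rintro ⟨k⟩ ⟨l⟩ ⟨m⟩
    exact Gown.mk_mul_assoc k l m

/-- The element `[x]` of the gown, for `x ∈ S \ 0`. -/
def Gown.of (x : NZ S) : Gown S := Gown.mk ⟨[x], by simp, List.isChain_singleton x⟩

theorem Gown.of_mul_of (x y : NZ S) (h : x.1 * y.1 ≠ 0) :
    Gown.of x * Gown.of y = Gown.of ⟨x.1 * y.1, h⟩ := by
  refine congrArg Gown.mk (Subtype.ext ?_)
  simp [Seq.mul, glue, h]

variable {A : Type v} [AddCommGroup A] [ZeroModule S A]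

/-- `x_1 (⋯ (x_m a) ⋯)`. -/
def seqAct (l : List (NZ S)) (a : A) : A := l.foldr ZeroModule.act a

theorem seqAct_append (l m : List (NZ S)) (a : A) :
    seqAct (l ++ m) a = seqAct l (seqAct m a) := by
  simp [seqAct]

theorem act_act_eq (x y z : NZ S) (h : x.1 = y.1 * z.1) (a : A) :
    ZeroModule.act x a = ZeroModule.act y (ZeroModule.act z a) := by
  obtain ⟨x, hx⟩ := x
  dsimp only at h
  subst h
  exact (ZeroModule.act_act y z hx a).symm

theorem seqAct_rho {l m : List (NZ S)} (h : Rho l m) (a : A) : seqAct l a = seqAct m a := by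
  cases h with
  | slide p q x₁ x₂ y₁ y₂ w h₁ h₂ =>
    have hw : w ≠ 0 := by
      rintro rfl
      exact x₁.2 (by rw [h₁, mul_zero])
    rw [seqAct_append, seqAct_append]
    simp only [seqAct, List.foldr_cons]
    rw [act_act_eq x₁ y₁ ⟨w, hw⟩ h₁, act_act_eq y₂ ⟨w, hw⟩ x₂ h₂]
  | split p q x₀ x₁ x₂ y₀ y₁ w z h h₀ h₁ =>
    have hw : w ≠ 0 := by
      rintro rfl
      exact x₁.2 (by rw [h, zero_mul])
    have hz : z ≠ 0 := by
      rintro rfl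
      exact x₁.2 (by rw [h, mul_zero])
    rw [seqAct_append, seqAct_append]
    simp only [seqAct, List.foldr_cons]
    rw [act_act_eq x₁ ⟨w, hw⟩ ⟨z, hz⟩ h, act_act_eq y₀ x₀ ⟨w, hw⟩ h₀,
      act_act_eq y₁ ⟨z, hz⟩ x₂ h₁]

theorem seqAct_glue {l m : List (NZ S)} (hl : l ≠ []) (hm : m ≠ []) (a : A) :
    seqAct (glue l m) a = seqAct l (seqAct m a) := by
  obtain ⟨p, x, rfl⟩ := List.eq_nil_or_concat' l |>.resolve_left hl
  obtain ⟨y, m, rfl⟩ := List.exists_cons_of_ne_nil hm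
  by_cases h : x.1 * y.1 = 0
  · rw [glue_of_eq_zero h, List.append_cons, seqAct_append]
  · rw [glue_of_ne_zero h, seqAct_append, seqAct_append]
    simp only [seqAct, List.foldr_cons, List.foldr_nil]
    rw [ZeroModule.act_act x y h]

/-- A 0-module over `S` becomes a module over the gown by
`[x_1, …, x_m] a = x_1 (⋯ (x_m a) ⋯)`. -/
instance : SemigroupModule (Gown S) A where
  smul t a := Quot.lift (fun l : Seq S => seqAct l.1 a) (fun _ _ h => seqAct_rho h a) t
  smul_add := by
    rintro ⟨l, hl⟩ a b
    change seqAct l (a + b) = seqAct l a + seqAct l b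
    clear hl
    induction l with
    | nil => rfl
    | cons x l ih =>
      simp only [seqAct, List.foldr_cons] at ih ⊢
      rw [ih, ZeroModule.act_add]
  mul_smul := by
    rintro ⟨l, hl⟩ ⟨m, hm⟩ a
    exact seqAct_glue hl.1 hm.1 a

theorem Gown.of_smul (x : NZ S) (a : A) : Gown.of x • a = ZeroModule.act x a := rfl

end Gown

/-! ### The comparison map -/

section Comparison

variable (S : Type u) (A : Type v) [SemigroupWithZero S] [AddCommGroup A] [ZeroModule S A]

/-- The homomorphism `η^n : C^n(S̃, A) → C_0^n(S, A)`,
`(η^n f) (x_1, …, x_n) = f ([x_1], …, [x_n])` for `x_1 ⋯ x_n ≠ 0`. -/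
def eta (n : ℕ) : Cochain (Gown S) A n →+ ZeroCochain S A n where
  toFun f := fun x => f fun i => Gown.of ⟨x.1 i, x.2.ne_zero i⟩
  map_zero' := rfl
  map_add' _ _ := rfl

theorem eta_coboundary (n : ℕ) (f : Cochain (Gown S) A n) :
    eta S A (n + 1) (coboundary (Gown S) A n f) = zeroCoboundary S A n (eta S A n f) := by
  funext x
  simp only [eta, coboundary, zeroCoboundary, AddMonoidHom.coe_mk, ZeroHom.coe_mk, Gown.of_smul]
  congr 1
  refine Finset.sum_congr rfl fun j _ => ?_
  congr 2
  funext k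
  have hk := (x.2.contract j).ne_zero k
  unfold Fin.contractNth at hk ⊢
  split_ifs with h1 h2
  · rfl
  · rw [if_neg h1, if_pos h2] at hk
    exact Gown.of_mul_of _ _ hk
  · rfl

/-- The homomorphism `ε^n : H^n(S̃, A) → H_0^n(S, A)` induced by `η^n`. -/
def epsilon (n : ℕ) : EMCohomology (Gown S) A n →+ ZeroCohomologyGroup S A n :=
  QuotientAddGroup.map _ _
    (((eta S A n).comp (cocycles (Gown S) A n).subtype).codRestrict (zeroCocycles S A n)
      (by
        rintro ⟨f, hf⟩
        change coboundary (Gown S) A n f = 0 at hf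
        change zeroCoboundary S A n (eta S A n f) = 0
        rw [← eta_coboundary, hf, map_zero]))
    (by
      rintro ⟨f, hf⟩ hb
      cases n with
      | zero =>
        have h0 : f = 0 := hb
        change eta S A 0 f = 0
        rw [h0, map_zero]
      | succ n =>
        obtain ⟨g, hg⟩ : ∃ g, coboundary (Gown S) A n g = f := hb
        exact ⟨eta S A n g, by rw [← eta_coboundary, hg]; rfl⟩)

end Comparison

end

end ZeroCohomology

/-! Each rule of `Rho` turns a vanishing product of neighbours into `abc = 0` with `ab` and `bc`
nonzero. Over a semigroup that is categorical at zero no such triple exists, so `Rho` never holds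
between sequences (`CategoricalAtZero.not_rho`) and the gown is the set of sequences itself. Hence
every element is uniquely a letter `x` or a concatenation `x * w` with `x` a letter and `x * head w
= 0`.

The letter map is injective, so `eta` is surjective in every degree, and it is injective in degree
0. By the usual diagram chase it remains to prove that the kernel of `eta` is exact in positive
degrees. Nonzero product is equivalent to nonzero products of neighbours here, so the kernel
consists of the cochains that vanish on good sequences.

Exactness comes from an acyclic matching on the remaining sequences. A stuck sequence starts with
letters whose neighbouring products are nonzero, up to the first place where a letter and the next
entry multiply by concatenation; merging there gives its partner `(y₁, …, yₖ, y * w, …)`, where `y *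
w` is the first entry that is not a letter. Given a cocycle `f` of the kernel, set `primitive` to 0
on good and stuck sequences and choose its values on the partners so that its coboundary equals `f`
on stuck sequences (`listCoboundary_primitive_of_stuckAfter`). The difference is then a cocycle that
vanishes on good and stuck sequences, and such a cocycle is zero
(`eq_zero_of_listCoboundary_eq_zero`). -/

namespace ZeroCohomology

/-! ### Cochains as functions on lists -/

section Extend

variable {T : Type u} {A : Type v} [AddCommGroup A]

/-- Extension by zero of an `n`-cochain to sequences of any length. -/
noncomputable def extendCochain {n : ℕ} (f : Cochain T A n) (l : List T) : A :=
  if h : l.length = n then f fun i => l.get (i.cast h.symm) else 0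

theorem extendCochain_ofFn {n : ℕ} (f : Cochain T A n) (x : Fin n → T) :
    extendCochain f (List.ofFn x) = f x := by
  rw [extendCochain, dif_pos (by simp)]
  congr 1
  funext i
  simp

end Extend

/-! ### The bar differential on lists -/

section Bar

variable {T : Type u} {A : Type v} [Semigroup T] [AddCommGroup A]

/-- The alternating sum of the inner faces and of the last face of the tuple `x :: l`. -/
def contractSum : (List T → A) → T → List T → A
  | f, _, [] => f []
  | f, x, y :: l => f ((x * y) :: l) - contractSum (fun m => f (x :: m)) y l

theorem contractSum_sub (f g : List T → A) (x : T) (l : List T) :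
    contractSum (fun m => f m - g m) x l = contractSum f x l - contractSum g x l := by
  induction l generalizing f g x with
  | nil => rfl
  | cons y l ih => simp only [contractSum, ih]; abel

/-- The pairwise cancellation of iterated contractions, peeled from the head; associativity enters
only here. It is the combinatorial core of `∂ ∘ ∂ = 0`. -/
theorem contractSum_mul (f : List T → A) (x y : T) (l : List T) :
    contractSum f (x * y) l = contractSum (fun m => contractSum f x m) y l := by
  induction l generalizing f x y with
  | nil => rfl
  | cons z l ih =>
    simp only [contractSum]
    rw [contractSum_sub, ← ih, mul_assoc]
    abel

theorem contractSum_eq_zero_of_length (f : List T → A) (x : T) (l : List T)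
    (hf : ∀ m : List T, m.length = l.length → f m = 0) : contractSum f x l = 0 := by
  induction l generalizing f x with
  | nil => exact hf [] rfl
  | cons y l ih =>
    rw [contractSum, hf _ (by simp), ih _ _ fun m hm => hf _ (by simp [hm]), sub_zero]

theorem contractSum_ofFn {n : ℕ} (g : List T → A) (x : Fin (n + 1) → T) :
    contractSum g (x 0) (List.ofFn fun i => x i.succ) =
      ∑ j : Fin (n + 1), (-1 : ℤ) ^ (j : ℕ) • g (List.ofFn (Fin.contractNth j (· * ·) x)) := by
  induction n generalizing g with
  | zero => simp [contractSum]
  | succ n ih =>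
    rw [List.ofFn_succ, contractSum, Fin.sum_univ_succ]
    have h := ih (fun m => g (x 0 :: m)) (fun i => x i.succ)
    rw [h, sub_eq_add_neg, ← Finset.sum_neg_distrib]
    congr 1
    · rw [List.ofFn_succ]
      simp [Fin.contractNth]
    · refine Finset.sum_congr rfl fun j _ => ?_
      rw [List.ofFn_succ]
      simp [Fin.contractNth, pow_succ, Fin.castSucc_succ]
      rfl

variable [SemigroupModule T A]

instance (priority := 50) SemigroupModule.toDistribSMul : DistribSMul T A where
  smul_zero t := by simpa using SemigroupModule.smul_add t (0 : A) 0
  smul_add := SemigroupModule.smul_add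

theorem contractSum_smul (t : T) (f : List T → A) (x : T) (l : List T) :
    contractSum (fun m => t • f m) x l = t • contractSum f x l := by
  induction l generalizing f x with
  | nil => rfl
  | cons y l ih => simp only [contractSum, ih, smul_sub]

/-- The coboundary operator on functions of nonempty finite sequences of any length. -/
def listCoboundary (f : List T → A) : List T → A
  | [] => 0
  | x :: l => x • f l - contractSum f x l

theorem listCoboundary_sub (f g : List T → A) (l : List T) :
    listCoboundary (fun m => f m - g m) l = listCoboundary f l - listCoboundary g l := by
  cases l with
  | nil => simp [listCoboundary]
  | cons x l => simp only [listCoboundary, contractSum_sub, smul_sub]; abel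

theorem listCoboundary_listCoboundary (f : List T → A) (l : List T) :
    listCoboundary (listCoboundary f) l = 0 := by
  cases l with
  | nil => rfl
  | cons x l =>
    cases l with
    | nil => simp [listCoboundary, contractSum]
    | cons y l =>
      simp only [listCoboundary, contractSum]
      rw [contractSum_sub, contractSum_smul, ← contractSum_mul, SemigroupModule.mul_smul, smul_sub]
      abel

theorem listCoboundary_ofFn {n : ℕ} (g : List T → A) (x : Fin (n + 1) → T) :
    listCoboundary g (List.ofFn x) = coboundary T A n (fun y => g (List.ofFn y)) x := by
  rw [List.ofFn_succ]
  simp only [listCoboundary, coboundary, AddMonoidHom.coe_mk, ZeroHom.coe_mk]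
  rw [contractSum_ofFn, sub_eq_add_neg, ← Finset.sum_neg_distrib]
  simp [pow_succ]

theorem listCoboundary_extendCochain {n : ℕ} {f : Cochain T A n} (hf : coboundary T A n f = 0)
    (l : List T) : listCoboundary (extendCochain f) l = 0 := by
  cases l with
  | nil => rfl
  | cons x l =>
    by_cases h : l.length = n
    · subst h
      obtain ⟨y, hy⟩ : ∃ y : Fin (l.length + 1) → T, List.ofFn y = x :: l :=
        ⟨(x :: l).get, by exact List.ofFn_get (x :: l)⟩
      rw [← hy, listCoboundary_ofFn]
      simp only [extendCochain_ofFn]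
      exact congrFun hf y
    -- All faces of `x :: l` have the length of `l`, so off degree `n` every term is the default
    -- value 0.
    · have h0 : ∀ m : List T, m.length = l.length → extendCochain f m = 0 := fun m hm =>
        dif_neg (hm ▸ h)
      rw [listCoboundary, h0 l rfl, smul_zero, contractSum_eq_zero_of_length _ _ _ h0, sub_zero]

theorem coboundary_coboundary {n : ℕ} (f : Cochain T A n) :
    coboundary T A (n + 1) (coboundary T A n f) = 0 := by
  funext x
  have h := listCoboundary_listCoboundary (extendCochain f) (List.ofFn x)
  rw [listCoboundary_ofFn] at h
  simp only [listCoboundary_ofFn, extendCochain_ofFn] at h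
  exact h

end Bar

/-! ### Normal forms in the gown -/

section GownStructure

variable {S : Type u} [SemigroupWithZero S]

theorem CategoricalAtZero.mul_mul_ne_zero (hS : CategoricalAtZero S) {x y z : S}
    (hxy : x * y ≠ 0) (hyz : y * z ≠ 0) : x * y * z ≠ 0 :=
  fun h => (hS x y z h).elim hxy hyz

/-- Over a semigroup that is categorical at zero the relation `ρ` is empty. -/
theorem CategoricalAtZero.not_rho (hS : CategoricalAtZero S) (l m : Seq S) : ¬ Rho l.1 m.1 := by
  obtain ⟨l, -, cl⟩ := l
  obtain ⟨m, -, -⟩ := m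
  intro h
  dsimp only at h
  cases h with
  | slide p q x₁ x₂ y₁ y₂ w h₁ h₂ =>
    rw [List.isChain_append_cons_cons] at cl
    -- Here `y₁ w x₂ = x₁ x₂ = 0`, while `y₁ w = x₁` and `w x₂ = y₂` are nonzero; the other case
    -- uses `x₀ w z` in the same way.
    refine hS.mul_mul_ne_zero ?_ ?_ (h₁ ▸ cl.2.1)
    · exact h₁ ▸ x₁.2
    · exact h₂ ▸ y₂.2
  | split p q x₀ x₁ x₂ y₀ y₁ w z h h₀ h₁ =>
    rw [List.isChain_append_cons_cons, h, ← mul_assoc] at cl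
    refine hS.mul_mul_ne_zero ?_ ?_ cl.2.1
    · exact h₀ ▸ y₀.2
    · exact h ▸ x₁.2

/-- A sequence that represents a given element of the gown. -/
noncomputable def Gown.toSeq (t : Gown S) : Seq S := Quot.out t

theorem Gown.mk_toSeq (t : Gown S) : Gown.mk t.toSeq = t := Quot.out_eq t

/-- As no two sequences are related, the identity of `Seq S` descends to the quotient and inverts
`Gown.mk`. -/
theorem Gown.toSeq_mk (hS : CategoricalAtZero S) (l : Seq S) : (Gown.mk l).toSeq = l :=
  congrArg (Quot.lift id fun a b h => (hS.not_rho a b h).elim) (Gown.mk_toSeq (Gown.mk l))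

/-- The first letter of a sequence, and the rest of the sequence if there is any. -/
def Seq.split : Seq S → NZ S × Option (Seq S)
  | ⟨[], h⟩ => absurd rfl h.1
  | ⟨[x], _⟩ => (x, none)
  | ⟨x :: y :: l, h⟩ => (x, some ⟨y :: l, by simp, h.2.tail⟩)

/-- The first letter of an element of the gown, and the rest of it if there is any. -/
noncomputable def Gown.split (t : Gown S) : NZ S × Option (Gown S) :=
  (t.toSeq.split.1, t.toSeq.split.2.map Gown.mk)

/-- The first letter of an element of the gown. -/
noncomputable abbrev Gown.head (t : Gown S) : NZ S := t.split.1

/-- The number of letters of an element of the gown. -/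
noncomputable def Gown.size (t : Gown S) : ℕ := t.toSeq.1.length

theorem Gown.split_mk (hS : CategoricalAtZero S) (l : Seq S) :
    (Gown.mk l).split = (l.split.1, l.split.2.map Gown.mk) := by
  rw [Gown.split, Gown.toSeq_mk hS]

theorem Gown.size_mk (hS : CategoricalAtZero S) (l : Seq S) :
    (Gown.mk l).size = l.1.length := by
  rw [Gown.size, Gown.toSeq_mk hS]

theorem Gown.split_of (hS : CategoricalAtZero S) (x : NZ S) : (Gown.of x).split = (x, none) :=
  Gown.split_mk hS _

theorem Gown.of_injective (hS : CategoricalAtZero S) : Function.Injective (Gown.of (S := S)) :=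
  fun x y h => by simpa [Gown.split_of hS] using congrArg Gown.split h

theorem Gown.head_mk_cons (hS : CategoricalAtZero S) (x : NZ S) (l : List (NZ S))
    (h : x :: l ≠ [] ∧ (x :: l).IsChain fun x y => x.1 * y.1 = 0) :
    (Gown.mk ⟨x :: l, h⟩).head = x := by
  refine (congrArg Prod.fst (Gown.split_mk hS _)).trans ?_
  cases l <;> rfl

theorem Gown.of_mul_mk (x y : NZ S) (l : List (NZ S))
    (h : x :: y :: l ≠ [] ∧ (x :: y :: l).IsChain fun x y => x.1 * y.1 = 0) :
    Gown.of x * Gown.mk ⟨y :: l, by simp, h.2.tail⟩ = Gown.mk ⟨x :: y :: l, h⟩ := by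
  refine congrArg Gown.mk (Subtype.ext ?_)
  simp [Seq.mul, glue, (List.isChain_cons_cons.1 h.2).1]

theorem Gown.split_of_mul (hS : CategoricalAtZero S) {x : NZ S} {w : Gown S}
    (h : x.1 * w.head.1 = 0) : (Gown.of x * w).split = (x, some w) := by
  obtain ⟨l, rfl⟩ : ∃ l, w = Gown.mk l := ⟨w.toSeq, w.mk_toSeq.symm⟩
  obtain ⟨_ | ⟨y, l⟩, hl, cl⟩ := l
  · exact absurd rfl hl
  have hy : x.1 * y.1 = 0 := by
    have e := Gown.head_mk_cons hS y l ⟨hl, cl⟩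
    exact e ▸ h
  exact (congrArg Gown.split
    (Gown.of_mul_mk x y l ⟨by simp, List.isChain_cons_cons.2 ⟨hy, cl⟩⟩)).trans
    (Gown.split_mk hS _)

theorem Gown.eq_of_split_none (hS : CategoricalAtZero S) {t : Gown S} {x : NZ S}
    (h : t.split = (x, none)) : t = Gown.of x := by
  obtain ⟨l, rfl⟩ : ∃ l, t = Gown.mk l := ⟨t.toSeq, t.mk_toSeq.symm⟩
  rw [Gown.split_mk hS] at h
  obtain ⟨_ | ⟨y, _ | ⟨z, l⟩⟩, hl, cl⟩ := l
  · exact absurd rfl hl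
  · obtain rfl : y = x := congrArg Prod.fst h
    rfl
  · cases congrArg Prod.snd h

theorem Gown.of_split_some (hS : CategoricalAtZero S) {t w : Gown S} {x : NZ S}
    (h : t.split = (x, some w)) :
    t = Gown.of x * w ∧ x.1 * w.head.1 = 0 ∧ w.size < t.size := by
  obtain ⟨l, rfl⟩ : ∃ l, t = Gown.mk l := ⟨t.toSeq, t.mk_toSeq.symm⟩
  rw [Gown.split_mk hS] at h
  obtain ⟨_ | ⟨y, _ | ⟨z, l⟩⟩, hl, cl⟩ := l
  · exact absurd rfl hl
  · cases congrArg Prod.snd h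
  · obtain rfl : y = x := congrArg Prod.fst h
    obtain rfl : Gown.mk ⟨z :: l, by simp, cl.tail⟩ = w :=
      Option.some.inj (congrArg Prod.snd h)
    refine ⟨(Gown.of_mul_mk y z l ⟨hl, cl⟩).symm, ?_, ?_⟩
    · exact (Gown.head_mk_cons hS z l ⟨by simp, cl.tail⟩).symm ▸ (List.isChain_cons_cons.1 cl).1
    · exact ((Gown.size_mk hS _).trans_lt (Nat.lt_succ_self _)).trans_eq
        (Gown.size_mk hS ⟨y :: z :: l, hl, cl⟩).symm

theorem Gown.induction (hS : CategoricalAtZero S) {P : Gown S → Prop} (of : ∀ x, P (Gown.of x))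
    (of_mul : ∀ x w, x.1 * w.head.1 = 0 → P w → P (Gown.of x * w)) (t : Gown S) : P t := by
  induction hn : t.size using Nat.strong_induction_on generalizing t with
  | _ n ih =>
    rcases h : t.split with ⟨x, _ | w⟩
    · rw [Gown.eq_of_split_none hS h]
      exact of x
    · obtain ⟨e, hx, hw⟩ := Gown.of_split_some hS h
      rw [e]
      exact of_mul x w hx (ih _ (hn ▸ hw) w rfl)

theorem Gown.head_of (hS : CategoricalAtZero S) (x : NZ S) : (Gown.of x).head = x := by
  rw [Gown.head, Gown.split_of hS]

theorem Gown.head_of_mul (hS : CategoricalAtZero S) {x : NZ S} {w : Gown S}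
    (h : x.1 * w.head.1 = 0) : (Gown.of x * w).head = x := by
  rw [Gown.head, Gown.split_of_mul hS h]

/-- Right multiplication either keeps the first letter or multiplies it on the right, and both
preserve its annihilation by `x`. So contractions to the right of a cut do not destroy the cut. -/
theorem Gown.mul_head_mul_eq_zero (hS : CategoricalAtZero S) {x : NZ S} {w : Gown S}
    (h : x.1 * w.head.1 = 0) (t : Gown S) : x.1 * (w * t).head.1 = 0 := by
  induction w using Gown.induction hS generalizing x with
  | of y =>
    rw [Gown.head_of hS] at h
    by_cases hy : y.1 * t.head.1 = 0
    · rwa [Gown.head_of_mul hS hy]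
    · induction t using Gown.induction hS with
      | of z =>
        rw [Gown.head_of hS] at hy
        rw [Gown.of_mul_of y z hy, Gown.head_of hS, ← mul_assoc, h, zero_mul]
      | of_mul z t hz ih =>
        rw [Gown.head_of_mul hS hz] at hy
        rw [← mul_assoc, Gown.of_mul_of y z hy, Gown.head_of_mul hS, ← mul_assoc, h, zero_mul]
        rw [mul_assoc, hz, mul_zero]
  | of_mul y w hy ih =>
    rw [Gown.head_of_mul hS hy] at h
    rwa [mul_assoc, Gown.head_of_mul hS (ih hy)]

/-- Recursion on the number of letters of an element of the gown. -/
noncomputable def Gown.recSplit (hS : CategoricalAtZero S) {B : Type*} (a : NZ S → B)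
    (b : NZ S → Gown S → B → B) (t : Gown S) : B :=
  match h : t.split with
  | (x, none) => a x
  | (x, some w) =>
    have : w.size < t.size := (Gown.of_split_some hS h).2.2
    b x w (Gown.recSplit hS a b w)
termination_by t.size

theorem Gown.recSplit_of (hS : CategoricalAtZero S) {B : Type*} (a : NZ S → B)
    (b : NZ S → Gown S → B → B) (x : NZ S) : Gown.recSplit hS a b (Gown.of x) = a x := by
  rw [Gown.recSplit]
  split
  · rename_i h
    rw [Gown.split_of hS] at h
    simp_all
  · rename_i h
    rw [Gown.split_of hS] at h
    simp at h

theorem Gown.recSplit_of_mul (hS : CategoricalAtZero S) {B : Type*} (a : NZ S → B)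
    (b : NZ S → Gown S → B → B) {x : NZ S} {w : Gown S} (hx : x.1 * w.head.1 = 0) :
    Gown.recSplit hS a b (Gown.of x * w) = b x w (Gown.recSplit hS a b w) := by
  rw [Gown.recSplit]
  split
  · rename_i h
    rw [Gown.split_of_mul hS hx] at h
    simp at h
  · rename_i h
    rw [Gown.split_of_mul hS hx] at h
    simp only [Prod.mk.injEq, Option.some.injEq] at h
    obtain ⟨rfl, rfl⟩ := h
    rfl

end GownStructure

/-! ### The acyclic matching on sequences that are not good -/

section Matching

variable {S : Type u} [SemigroupWithZero S]

/-- The sequence `l` consists of letters, and in `x :: l` the products of neighbours are nonzero. -/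
def GoodAfter : NZ S → List (Gown S) → Prop
  | _, [] => True
  | x, t :: l => ∃ y, t = Gown.of y ∧ x.1 * y.1 ≠ 0 ∧ GoodAfter y l

/-- The sequence `l` consists of letters, and the products of neighbours are nonzero. -/
def Good : List (Gown S) → Prop
  | [] => True
  | t :: l => ∃ y, t = Gown.of y ∧ GoodAfter y l

/-- The sequence `l` begins with letters, the products of neighbours in `x :: l` being nonzero up to
a point where the product of a letter and the next entry is formed by concatenation. -/
def StuckAfter : NZ S → List (Gown S) → Prop
  | _, [] => False
  | x, t :: l => x.1 * t.head.1 = 0 ∨ ∃ y, t = Gown.of y ∧ x.1 * y.1 ≠ 0 ∧ StuckAfter y l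

theorem GoodAfter.cons {x y : NZ S} (h : x.1 * y.1 ≠ 0) {l : List (Gown S)}
    (hl : GoodAfter y l) : GoodAfter x (Gown.of y :: l) :=
  ⟨y, rfl, h, hl⟩

theorem GoodAfter.good {x : NZ S} {l : List (Gown S)} (hl : GoodAfter x l) :
    Good (Gown.of x :: l) :=
  ⟨x, rfl, hl⟩

theorem StuckAfter.of_cut {x : NZ S} {t : Gown S} (h : x.1 * t.head.1 = 0) (l : List (Gown S)) :
    StuckAfter x (t :: l) :=
  Or.inl h

theorem StuckAfter.cons {x y : NZ S} (h : x.1 * y.1 ≠ 0) {l : List (Gown S)}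
    (hl : StuckAfter y l) : StuckAfter x (Gown.of y :: l) :=
  Or.inr ⟨y, rfl, h, hl⟩

theorem GoodAfter.mul (hS : CategoricalAtZero S) {x y : NZ S} (h : x.1 * y.1 ≠ 0)
    {l : List (Gown S)} (hl : GoodAfter y l) : GoodAfter ⟨x.1 * y.1, h⟩ l := by
  cases l with
  | nil => trivial
  | cons t l =>
    obtain ⟨z, rfl, hz, hl⟩ := hl
    exact ⟨z, rfl, hS.mul_mul_ne_zero h hz, hl⟩

theorem StuckAfter.mul (hS : CategoricalAtZero S) {x y : NZ S} (h : x.1 * y.1 ≠ 0)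
    {l : List (Gown S)} (hl : StuckAfter y l) : StuckAfter ⟨x.1 * y.1, h⟩ l := by
  cases l with
  | nil => exact hl
  | cons t l =>
    rcases hl with ht | ⟨z, rfl, hz, hl⟩
    · exact Or.inl (by rw [mul_assoc, ht, mul_zero])
    · exact Or.inr ⟨z, rfl, hS.mul_mul_ne_zero h hz, hl⟩

variable {A : Type v} [AddCommGroup A]

/-- Every nonempty face of `w :: l` begins with `w` or with a right multiple of `w`, hence still has
a cut after `x`; `h0` covers the empty face. -/
theorem contractSum_eq_zero_of_cut (hS : CategoricalAtZero S) {g : List (Gown S) → A} {x : NZ S}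
    {w : Gown S} (hw : x.1 * w.head.1 = 0) (h0 : g [] = 0)
    (h : ∀ (t : Gown S) (m : List (Gown S)), x.1 * t.head.1 = 0 → g (t :: m) = 0)
    (l : List (Gown S)) : contractSum g w l = 0 := by
  cases l with
  | nil => exact h0
  | cons t l =>
    rw [contractSum, h _ _ (Gown.mul_head_mul_eq_zero hS hw t),
      contractSum_eq_zero_of_length _ _ _ fun m _ => h w m hw, sub_zero]

theorem contractSum_of_goodAfter (hS : CategoricalAtZero S) {g : List (Gown S) → A} {x y : NZ S}
    (hxy : x.1 * y.1 ≠ 0) (h : ∀ m, GoodAfter x m → g m = 0) {l : List (Gown S)}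
    (hl : GoodAfter y l) : contractSum g (Gown.of y) l = 0 := by
  induction l generalizing g x y with
  | nil => exact h [] trivial
  | cons t l ih =>
    obtain ⟨z, rfl, hz, hl⟩ := hl
    rw [contractSum, Gown.of_mul_of y z hz,
      h _ (.cons (by rw [← mul_assoc]; exact hS.mul_mul_ne_zero hxy hz) (hl.mul hS hz)),
      ih hz (fun m hm => h _ (.cons hxy hm)) hl, sub_zero]

open Classical in
/-- The function whose value at a sequence `y_1, …, y_k, t, …` with `t` not a letter is, up to sign,
the value of `φ` at the sequence in which the first letter of `t` is split off. -/
noncomputable def spread : NZ S → (List (Gown S) → A) → List (Gown S) → A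
  | _, _, [] => 0
  | x, φ, t :: l =>
    if x.1 * t.head.1 = 0 then 0
    else match t.split with
      -- Each letter passed moves the merging face one place to the right and flips its sign in the
      -- coboundary.
      | (y, none) => spread y (fun m => -φ (Gown.of y :: m)) l
      | (y, some w) => φ (Gown.of y :: w :: l)

theorem spread_of_cut {x : NZ S} {t : Gown S} (h : x.1 * t.head.1 = 0)
    (φ : List (Gown S) → A) (l : List (Gown S)) : spread x φ (t :: l) = 0 := by
  rw [spread, if_pos h]

theorem spread_of (hS : CategoricalAtZero S) {x y : NZ S} (h : x.1 * y.1 ≠ 0)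
    (φ : List (Gown S) → A) (l : List (Gown S)) :
    spread x φ (Gown.of y :: l) = spread y (fun m => -φ (Gown.of y :: m)) l := by
  rw [spread, if_neg (by rwa [Gown.head_of hS]), Gown.split_of hS]

theorem spread_of_mul (hS : CategoricalAtZero S) {x y : NZ S} (h : x.1 * y.1 ≠ 0) {w : Gown S}
    (hw : y.1 * w.head.1 = 0) (φ : List (Gown S) → A) (l : List (Gown S)) :
    spread x φ (Gown.of y * w :: l) = φ (Gown.of y :: w :: l) := by
  rw [spread, if_neg (by rwa [Gown.head_of_mul hS hw]), Gown.split_of_mul hS hw]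

theorem spread_of_stuckAfter (hS : CategoricalAtZero S) {x : NZ S} (φ : List (Gown S) → A)
    {l : List (Gown S)} (hl : StuckAfter x l) : spread x φ l = 0 := by
  induction l generalizing x φ with
  | nil => rfl
  | cons t l ih =>
    rcases hl with ht | ⟨y, rfl, hy, hl⟩
    · exact spread_of_cut ht φ l
    · rw [spread_of hS hy, ih _ hl]

theorem spread_of_goodAfter (hS : CategoricalAtZero S) {x : NZ S} (φ : List (Gown S) → A)
    {l : List (Gown S)} (hl : GoodAfter x l) : spread x φ l = 0 := by
  induction l generalizing x φ with
  | nil => rfl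
  | cons t l ih =>
    obtain ⟨y, rfl, hy, hl⟩ := hl
    rw [spread_of hS hy, ih _ hl]

/-- Of all these faces of a stuck sequence only the one merging at the cut contributes: earlier
mergers of letters, and faces beyond the cut, leave a stuck sequence, where `spread` is 0. -/
theorem contractSum_spread (hS : CategoricalAtZero S) {x y : NZ S} (hxy : x.1 * y.1 ≠ 0)
    (φ : List (Gown S) → A) {l : List (Gown S)} (hl : StuckAfter y l) :
    contractSum (spread x φ) (Gown.of y) l = φ (Gown.of y :: l) := by
  induction l generalizing x y φ with
  | nil => exact hl.elim
  | cons t l ih =>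
    rw [contractSum]
    simp only [spread_of hS hxy]
    rcases hl with ht | ⟨z, rfl, hz, hl⟩
    · rw [spread_of_mul hS hxy ht, contractSum_eq_zero_of_cut hS ht rfl
        (fun t m h => spread_of_cut h _ m), sub_zero]
    · have hxyz : x.1 * (y.1 * z.1) ≠ 0 := by
        rw [← mul_assoc]
        exact hS.mul_mul_ne_zero hxy hz
      rw [Gown.of_mul_of y z hz, ih hz _ hl, spread_of_stuckAfter hS _
        (.cons hxyz (hl.mul hS hz))]
      abel

/-- A sequence that is neither good nor stuck is a face of its stuck partner, and `g` vanishes on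
the other faces in the sum; so the relation `h` at the partner isolates its value. -/
theorem eq_zero_of_contractSum_eq_zero (hS : CategoricalAtZero S) {g : List (Gown S) → A}
    {x : NZ S} (hgood : ∀ m, GoodAfter x m → g m = 0) (hstuck : ∀ m, StuckAfter x m → g m = 0)
    (h : ∀ (y : NZ S) (m : List (Gown S)), x.1 * y.1 ≠ 0 → StuckAfter y m →
      contractSum g (Gown.of y) m = 0) (l : List (Gown S)) : g l = 0 := by
  induction l generalizing g x with
  | nil => exact hgood [] trivial
  | cons t l ih =>
    by_cases hx : x.1 * t.head.1 = 0
    · exact hstuck _ (Or.inl hx)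
    induction t using Gown.induction hS with
    | of y =>
      rw [Gown.head_of hS] at hx
      refine ih (g := fun m => g (Gown.of y :: m)) (x := y)
        (fun m hm => hgood _ (.cons hx hm)) (fun m hm => hstuck _ (.cons hx hm))
        fun z m hz hm => ?_
      have e := h y (Gown.of z :: m) hx (.cons hz hm)
      have hxyz : x.1 * (y.1 * z.1) ≠ 0 := by
        rw [← mul_assoc]
        exact hS.mul_mul_ne_zero hx hz
      rw [contractSum, Gown.of_mul_of y z hz,
        hstuck _ (.cons hxyz (hm.mul hS hz)), zero_sub, neg_eq_zero] at e
      exact e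
    | of_mul y w hy _ =>
      rw [Gown.head_of_mul hS hy] at hx
      -- The partner of `y * w :: l` is `y :: w :: l`.
      have e := h y (w :: l) hx (.of_cut hy l)
      rwa [contractSum, contractSum_eq_zero_of_cut (g := fun m => g (Gown.of y :: m)) hS hy
        (hgood _ (.cons hx (l := []) trivial))
        (fun t m ht => hstuck _ (.cons hx (.of_cut ht m))), sub_zero] at e

variable [ZeroModule S A]

/-- Faces of good sequences are good, so vanishing on good sequences defines a subcomplex. -/
theorem listCoboundary_of_good (hS : CategoricalAtZero S) {f : List (Gown S) → A}
    (hf : ∀ m, Good m → f m = 0) {l : List (Gown S)} (hl : Good l) : listCoboundary f l = 0 := by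
  cases l with
  | nil => rfl
  | cons t l =>
    obtain ⟨x, rfl, hl⟩ := hl
    cases l with
    | nil => simp [listCoboundary, contractSum, hf [] trivial]
    | cons t l =>
      obtain ⟨y, rfl, hy, hl⟩ := hl
      rw [listCoboundary, contractSum, Gown.of_mul_of x y hy, hf _ hl.good,
        hf _ (hl.mul hS hy).good,
        contractSum_of_goodAfter hS hy (fun m hm => hf _ hm.good) hl]
      simp

theorem eq_zero_of_listCoboundary_eq_zero (hS : CategoricalAtZero S) {f : List (Gown S) → A}
    (hd : ∀ l, listCoboundary f l = 0) (hgood : ∀ l, Good l → f l = 0)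
    (hstuck : ∀ x l, StuckAfter x l → f (Gown.of x :: l) = 0) (l : List (Gown S)) : f l = 0 := by
  cases l with
  | nil => exact hgood [] trivial
  | cons t l =>
    induction t using Gown.induction hS with
    | of x =>
      refine eq_zero_of_contractSum_eq_zero hS (g := fun m => f (Gown.of x :: m)) (x := x)
        (fun m hm => hgood _ hm.good) (fun m hm => hstuck x m hm) (fun y m hy hm => ?_) l
      have e := hd (Gown.of x :: Gown.of y :: m)
      rwa [listCoboundary, contractSum, Gown.of_mul_of x y hy, hstuck y m hm,
        hstuck _ m (hm.mul hS hy), smul_zero, zero_sub, zero_sub, neg_neg] at e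
    | of_mul x w hw ih =>
      -- In this relation the face `x * w :: l` is isolated: the leading face `w :: l` is covered by
      -- induction on the first entry, and the others are stuck or the single letter `x`.
      have e := hd (Gown.of x :: w :: l)
      rwa [listCoboundary, contractSum, ih, smul_zero,
        contractSum_eq_zero_of_cut (g := fun m => f (Gown.of x :: m)) hS hw
        (hgood _ (GoodAfter.good (l := []) trivial)) (fun t m ht => hstuck x _ (.of_cut ht m)),
        sub_zero, zero_sub, neg_eq_zero] at e

/-- A function that vanishes on the good sequences and whose coboundary agrees with `f` on the
sequences that get stuck. -/
noncomputable def primitive (hS : CategoricalAtZero S) (f : List (Gown S) → A) :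
    List (Gown S) → A
  | [] => 0
  | t :: l => Gown.recSplit hS (fun x l => spread x (fun m => f (Gown.of x :: m)) l)
      -- This solves the equation "coboundary equals `f`" at the stuck sequence `x :: w :: l` for
      -- the value at its partner `x * w :: l`; `g l` is the value already found at `w :: l`.
      (fun x w g l => Gown.of x • g l - f (Gown.of x :: w :: l)) t l

theorem primitive_of (hS : CategoricalAtZero S) (f : List (Gown S) → A) (x : NZ S)
    (l : List (Gown S)) :
    primitive hS f (Gown.of x :: l) = spread x (fun m => f (Gown.of x :: m)) l := by
  rw [primitive, Gown.recSplit_of]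

theorem primitive_of_mul (hS : CategoricalAtZero S) (f : List (Gown S) → A) {x : NZ S}
    {w : Gown S} (hw : x.1 * w.head.1 = 0) (l : List (Gown S)) :
    primitive hS f (Gown.of x * w :: l) =
      Gown.of x • primitive hS f (w :: l) - f (Gown.of x :: w :: l) := by
  rw [primitive, Gown.recSplit_of_mul hS _ _ hw, primitive]

theorem primitive_of_good (hS : CategoricalAtZero S) (f : List (Gown S) → A)
    {l : List (Gown S)} (hl : Good l) : primitive hS f l = 0 := by
  cases l with
  | nil => rfl
  | cons t l =>
    obtain ⟨x, rfl, hl⟩ := hl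
    rw [primitive_of, spread_of_goodAfter hS _ hl]

theorem listCoboundary_primitive_of_stuckAfter (hS : CategoricalAtZero S)
    (f : List (Gown S) → A) {x : NZ S} {l : List (Gown S)} (hl : StuckAfter x l) :
    listCoboundary (primitive hS f) (Gown.of x :: l) = f (Gown.of x :: l) := by
  cases l with
  | nil => exact hl.elim
  | cons t l =>
    rw [listCoboundary, contractSum]
    simp only [primitive_of]
    rcases hl with ht | ⟨y, rfl, hy, hl⟩
    · rw [primitive_of_mul hS f ht, contractSum_eq_zero_of_cut hS ht rfl
        (fun t m h => spread_of_cut h _ m)]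
      abel
    · rw [Gown.of_mul_of x y hy, primitive_of, primitive_of, contractSum_spread hS hy _ hl,
        spread_of_stuckAfter hS _ hl, spread_of_stuckAfter hS _ (hl.mul hS hy)]
      simp

/-- The complex of functions that vanish on the good sequences is acyclic. -/
theorem listCoboundary_primitive (hS : CategoricalAtZero S) {f : List (Gown S) → A}
    (hd : ∀ l, listCoboundary f l = 0) (hf : ∀ l, Good l → f l = 0) (l : List (Gown S)) :
    listCoboundary (primitive hS f) l = f l := by
  refine (sub_eq_zero.1 (eq_zero_of_listCoboundary_eq_zero hS
    (f := fun m => f m - listCoboundary (primitive hS f) m) (fun m => ?_) (fun m hm => ?_)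
    (fun x m hm => ?_) l)).symm
  · rw [listCoboundary_sub, hd, listCoboundary_listCoboundary, sub_zero]
  · rw [hf m hm, listCoboundary_of_good hS (fun m hm => primitive_of_good hS f hm) hm, sub_zero]
  · rw [listCoboundary_primitive_of_stuckAfter hS f hm, sub_self]

end Matching

/-! ### The kernel of `eta` and the diagram chase -/

section Comparison

variable {S : Type u} {A : Type v} [SemigroupWithZero S] [AddCommGroup A]

/-- By categoricity at zero, a product vanishes only if two neighbours already multiply to 0. This
identifies good sequences with the domain of 0-cochains. -/
theorem CategoricalAtZero.goodAfter_iff (hS : CategoricalAtZero S) (x : NZ S) (l : List (NZ S)) :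
    GoodAfter x (l.map Gown.of) ↔
      (x.1 : WithOne S) * (l.map fun y => (y.1 : WithOne S)).prod ≠ ((0 : S) : WithOne S) := by
  induction l generalizing x with
  | nil => simpa [GoodAfter] using x.2
  | cons y l ih =>
    by_cases hxy : x.1 * y.1 = 0
    · refine iff_of_false ?_ ?_
      · rintro ⟨z, hz, hxz, -⟩
        rw [← Gown.of_injective hS hz] at hxz
        exact hxz hxy
      · rw [List.map_cons, List.prod_cons, ← mul_assoc, ← WithOne.coe_mul, hxy, coe_zero_mul]
        exact not_not.2 rfl
    · have e : GoodAfter x ((y :: l).map Gown.of) ↔ GoodAfter y (l.map Gown.of) := by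
        refine ⟨?_, fun h => ⟨y, rfl, hxy, h⟩⟩
        rintro ⟨z, hz, -, h⟩
        rwa [← Gown.of_injective hS hz] at h
      rw [e, ih, List.map_cons, List.prod_cons, ← mul_assoc, ← WithOne.coe_mul]
      generalize (l.map fun y => (y.1 : WithOne S)).prod = w
      cases w with
      | one =>
        rw [mul_one, mul_one, Ne, Ne, WithOne.coe_inj, WithOne.coe_inj]
        exact iff_of_true y.2 hxy
      | coe a =>
        rw [← WithOne.coe_mul, ← WithOne.coe_mul, Ne, Ne, WithOne.coe_inj, WithOne.coe_inj]
        refine ⟨hS.mul_mul_ne_zero hxy, fun h h0 => h ?_⟩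
        rw [mul_assoc, h0, mul_zero]

theorem CategoricalAtZero.good_iff (hS : CategoricalAtZero S) (l : List (NZ S)) :
    Good (l.map Gown.of) ↔
      (l.map fun y => (y.1 : WithOne S)).prod ≠ ((0 : S) : WithOne S) := by
  cases l with
  | nil => simp [Good]
  | cons x l =>
    rw [List.map_cons, List.map_cons, List.prod_cons, ← hS.goodAfter_iff]
    refine ⟨?_, fun h => ⟨x, rfl, h⟩⟩
    rintro ⟨z, hz, h⟩
    rwa [← Gown.of_injective hS hz] at h

theorem GoodAfter.exists_map {x : NZ S} {l : List (Gown S)} (hl : GoodAfter x l) :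
    ∃ m : List (NZ S), l = m.map Gown.of := by
  induction l generalizing x with
  | nil => exact ⟨[], rfl⟩
  | cons t l ih =>
    obtain ⟨y, rfl, -, hl⟩ := hl
    obtain ⟨m, rfl⟩ := ih hl
    exact ⟨y :: m, rfl⟩

theorem Good.exists_map {l : List (Gown S)} (hl : Good l) :
    ∃ m : List (NZ S), l = m.map Gown.of := by
  cases l with
  | nil => exact ⟨[], rfl⟩
  | cons t l =>
    obtain ⟨y, rfl, hl⟩ := hl
    obtain ⟨m, rfl⟩ := hl.exists_map
    exact ⟨y :: m, rfl⟩

theorem good_ofFn (hS : CategoricalAtZero S) {n : ℕ} {x : Fin n → S} (hx : NonzeroProd x) :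
    Good (List.ofFn fun i => Gown.of ⟨x i, hx.ne_zero i⟩) := by
  have h := (hS.good_iff (List.ofFn fun i => (⟨x i, hx.ne_zero i⟩ : NZ S))).2
    (by rw [List.map_ofFn]; exact hx)
  rwa [List.map_ofFn] at h

theorem extendCochain_of_good (hS : CategoricalAtZero S) {n : ℕ} {f : Cochain (Gown S) A n}
    (hf : eta S A n f = 0) {l : List (Gown S)} (hl : Good l) : extendCochain f l = 0 := by
  obtain ⟨m, rfl⟩ := hl.exists_map
  by_cases h : m.length = n
  · subst h
    have hm := (hS.good_iff m).1 hl
    have hx : NonzeroProd fun i => (m.get i).1 := by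
      rw [← List.ofFn_get m, List.map_ofFn] at hm
      exact hm
    have e : List.ofFn (fun i => Gown.of (m.get i)) = m.map Gown.of := by
      conv_rhs => rw [← List.ofFn_get m, List.map_ofFn]
      rfl
    rw [← e, extendCochain_ofFn]
    exact congrFun hf ⟨_, hx⟩
  · exact dif_neg (by simpa using h)

open Classical in
theorem eta_surjective (hS : CategoricalAtZero S) (n : ℕ) :
    Function.Surjective (eta S A n) := by
  intro f
  have hinj : Function.Injective fun (x : {x : Fin n → S // NonzeroProd x}) i =>
      Gown.of (⟨x.1 i, x.2.ne_zero i⟩ : NZ S) := fun x y h =>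
    Subtype.ext (funext fun i => congrArg Subtype.val (Gown.of_injective hS (congrFun h i)))
  -- Any values off the image of the injective letter map would do; 0 is taken.
  exact ⟨Function.extend _ f 0, funext fun x => hinj.extend_apply f 0 x⟩

theorem eta_zero_injective : Function.Injective (eta S A 0) := by
  intro f g h
  funext x
  have e := congrFun h ⟨Fin.elim0, by simp [NonzeroProd, tupleProd]⟩
  rw [Subsingleton.elim x]
  exact e

variable [ZeroModule S A]

/-- The kernel of `η` has trivial cohomology in positive degrees. -/
theorem exists_coboundary_eq (hS : CategoricalAtZero S) {n : ℕ} {f : Cochain (Gown S) A (n + 1)}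
    (hd : coboundary (Gown S) A (n + 1) f = 0) (hf : eta S A (n + 1) f = 0) :
    ∃ g : Cochain (Gown S) A n, eta S A n g = 0 ∧ coboundary (Gown S) A n g = f := by
  refine ⟨fun x => primitive hS (extendCochain f) (List.ofFn x), ?_, ?_⟩
  · funext x
    exact primitive_of_good hS _ (good_ofFn hS x.2)
  · funext x
    rw [← listCoboundary_ofFn, listCoboundary_primitive hS (listCoboundary_extendCochain hd)
      (fun l => extendCochain_of_good hS hf), extendCochain_ofFn]

theorem exists_cocycle_eta_eq (hS : CategoricalAtZero S) {n : ℕ} {f : ZeroCochain S A n}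
    (hf : zeroCoboundary S A n f = 0) :
    ∃ g : Cochain (Gown S) A n, coboundary (Gown S) A n g = 0 ∧ eta S A n g = f := by
  obtain ⟨g, rfl⟩ := eta_surjective hS n f
  -- The coboundary of the lift `g` is a cocycle in the kernel of `eta`, of positive degree even for
  -- `n = 0`, so an element `h` of the kernel corrects `g` to a cocycle.
  obtain ⟨h, h0, hh⟩ := exists_coboundary_eq hS (coboundary_coboundary g)
    ((eta_coboundary S A n g).trans hf)
  exact ⟨g - h, by rw [map_sub, hh, sub_self], by rw [map_sub, h0, sub_zero]⟩

theorem mem_coboundaries_of_eta_mem (hS : CategoricalAtZero S) {n : ℕ} {f : Cochain (Gown S) A n}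
    (hd : coboundary (Gown S) A n f = 0) (hf : eta S A n f ∈ zeroCoboundaries S A n) :
    f ∈ coboundaries (Gown S) A n := by
  cases n with
  | zero =>
    have h0 : eta S A 0 f = 0 := hf
    exact eta_zero_injective (h0.trans (map_zero _).symm)
  | succ n =>
    obtain ⟨g, hg⟩ : ∃ g, zeroCoboundary S A n g = eta S A (n + 1) f := hf
    obtain ⟨g, rfl⟩ := eta_surjective hS n g
    -- After lifting the 0-cochain that bounds `eta f`, the difference is a cocycle in the kernel of
    -- `eta`.
    obtain ⟨h, -, hh⟩ := exists_coboundary_eq hS (f := f - coboundary (Gown S) A n g)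
      (by rw [map_sub, hd, coboundary_coboundary, sub_zero])
      (by rw [map_sub, eta_coboundary, hg, sub_self])
    exact ⟨h + g, by rw [map_add, hh, sub_add_cancel]⟩

end Comparison

end ZeroCohomology

theorem theorem5 {S : Type*} {A : Type*} [SemigroupWithZero S] [AddCommGroup A]
    [ZeroCohomology.ZeroModule S A] (hS : ZeroCohomology.CategoricalAtZero S) (n : ℕ) :
    Function.Bijective (ZeroCohomology.epsilon S A n) := by
  constructor
  · rw [injective_iff_map_eq_zero]
    intro c hc
    induction c using QuotientAddGroup.induction_on with
    | H f =>
      rw [QuotientAddGroup.eq_zero_iff]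
      exact ZeroCohomology.mem_coboundaries_of_eta_mem hS f.2
        ((QuotientAddGroup.eq_zero_iff (N := (ZeroCohomology.zeroCoboundaries S A n).addSubgroupOf
          (ZeroCohomology.zeroCocycles S A n)) _).1 hc)
  · intro c
    induction c using QuotientAddGroup.induction_on with
    | H f =>
      obtain ⟨g, hg, hgf⟩ := ZeroCohomology.exists_cocycle_eta_eq hS f.2
      exact ⟨QuotientAddGroup.mk ⟨g, hg⟩, congrArg QuotientAddGroup.mk (Subtype.ext hgf)⟩
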